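/- Let $\mathcal H_A=\mathcal H_B=\ell^2(\mathbb N_{\ge1})$ with standard orthonormal basis $\{|n\rangle\}_{n\ge1}$, and let $\mathcal H=\mathcal H_A\otimes\mathcal H_B$. For a bounded operator $T$ put $\|T\|_1=\operatorname{Tr}\sqrt{T^\dagger T}\in[0,\infty]$; a state is a positive operator of trace one. Let $\mathcal S$ be the set of separable states on $\mathcal H$, i.e. the trace-norm closed convex hull of the projections $|\psi\rangle\langle\psi|$ onto unit product vectors $|\psi\rangle=|\psi_A\rangle\otimes|\psi_B\rangle$. Let $\rho^\Gamma$ be the partial transpose of $\rho$ in the second factor, $\langle ab|\rho^\Gamma|cd\rangle=\langle ad|\rho|cb\rangle$. For a state $\rho$ on $\mathcal H$ define the negativity $N(\rho)=\frac12(\|\rho^\Gamma\|_1-1)$, the standard robustness $$R^{s}_{\mathcal S}(\rho)=\inf\Big\{1+\lambda:\ \lambda\ge0,\ \exists\,\sigma\in\mathcal S,\ \tfrac{\rho+\lambda\sigma}{1+\lambda}\in\mathcal S\Big\},$$ and the generalized robustness $$R_{\mathcal S}(\rho)=\inf\Big\{1+\lambda:\ \lambda\ge0,\ \exists\text{ states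 }\tau_k\text{ and bounded operators }\xi_k\text{ with }\|\xi_k-\rho\|_1\to0\text{ and }\tfrac{\xi_k+\lambda\tau_k}{1+\lambda}\in\mathcal S\ \forall k\Big\},$$ with $\inf\emptyset=\infty$. The Hilbert matrix $(H_{-1})_{n,m}=\frac1{n-m}$ for $n\ne m$, $(H_{-1})_{n,n}=0$ ($n,m\ge1$) defines a bounded operator $H_{-1}$ on $\mathcal H_A$. Let $D=\sum_{n\ge1}\frac{1}{\sqrt n\,\ln(n+1)}|n\rangle\langle n|$, $c=\operatorname{Tr}D^2=\sum_{n\ge1}\frac1{n\ln^2(n+1)}$, which is positive and finite, and $$\omega_\pm=\frac1c\,D\Big(\mathbb 1\pm\frac{i}{\pi}H_{-1}\Big)D,\qquad \rho_\pm=\sum_{n,m\ge1}(\omega_\pm)_{n,m}\,|nn\rangle\langle mm| .$$ Then $D$, $\rho_\pm$ and $\rho_\pm^\Gamma$ are (well-defined) bounded operators, $\omega_\pm$ and $\rho_\pm$ are states, and: 1. $\|\rho_\pm^\Gamma\|_1=\infty$, so that $N(\rho_\pm)=\infty$, and $R^{s}_{\mathcal S}(\rho_\pm)=\infty$; 2.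 $\frac12(\rho_++\rho_-)\in\mathcal S$, and $R_{\mathcal S}(\rho_\pm)\le2$. -/

import Mathlib

open scoped ENNReal Topology lp InnerProductSpace ComplexOrder
open Filter

noncomputable section

/-- The standard orthonormal basis vector `|i⟩` of `ℓ²(ι)`. -/
def ket {ι : Type} [DecidableEq ι] (i : ι) : ℓ²(ι, ℂ) := lp.single 2 i (1 : ℂ)

/-- `T` is the bounded operator on `ℓ²(ι)` with matrix elements `⟨i|T|j⟩ = a i j`. -/
def HasMatrix {ι : Type} [DecidableEq ι] (T : ℓ²(ι, ℂ) →L[ℂ] ℓ²(ι, ℂ)) (a : ι → ι → ℂ) : Prop :=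
  ∀ i j, ⟪ket i, T (ket j)⟫_ℂ = a i j

open Classical in
/-- The (unique) bounded operator on `ℓ²(ι)` whose matrix elements are `a i j`, if there is one;
the value is `0` if there is none. -/
def opOfMatrix {ι : Type} [DecidableEq ι] (a : ι → ι → ℂ) : ℓ²(ι, ℂ) →L[ℂ] ℓ²(ι, ℂ) :=
  if h : ∃ T : ℓ²(ι, ℂ) →L[ℂ] ℓ²(ι, ℂ), HasMatrix T a then h.choose else 0

/-- The absolute value `|T| = √(T† T)` of a bounded operator on a Hilbert space. -/
def opAbs {E : Type} [NormedAddCommGroup E] [InnerProductSpace ℂ E] [CompleteSpace E]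
    (T : E →L[ℂ] E) : E →L[ℂ] E := CFC.abs T

/-- The trace norm `‖T‖₁ = Tr |T|`, `|T| = √(T† T)`, of a bounded operator, with values in
`[0, ∞]`. The trace of the positive operator `|T|` is evaluated in the standard basis. -/
def traceNorm {ι : Type} [DecidableEq ι] (T : ℓ²(ι, ℂ) →L[ℂ] ℓ²(ι, ℂ)) : ℝ≥0∞ :=
  ∑' i, ENNReal.ofReal (⟪ket i, opAbs T (ket i)⟫_ℂ).re

/-- Density operators: positive operators of trace one. -/
def densityOperators (ι : Type) [DecidableEq ι] : Set (ℓ²(ι, ℂ) →L[ℂ] ℓ²(ι, ℂ)) :=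
  {ρ | ρ.IsPositive ∧ HasSum (fun i => ⟪ket i, ρ (ket i)⟫_ℂ) 1}

/-- Convergence of a sequence of operators in trace norm. -/
def TraceNormTendsto {ι : Type} [DecidableEq ι] (ξ : ℕ → ℓ²(ι, ℂ) →L[ℂ] ℓ²(ι, ℂ))
    (ρ : ℓ²(ι, ℂ) →L[ℂ] ℓ²(ι, ℂ)) : Prop :=
  Tendsto (fun k => traceNorm (ξ k - ρ)) atTop (𝓝 0)

/-- The closure of a set of operators in trace norm. -/
def traceNormClosure {ι : Type} [DecidableEq ι] (S : Set (ℓ²(ι, ℂ) →L[ℂ] ℓ²(ι, ℂ))) :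
    Set (ℓ²(ι, ℂ) →L[ℂ] ℓ²(ι, ℂ)) :=
  {ρ | ∃ ξ : ℕ → ℓ²(ι, ℂ) →L[ℂ] ℓ²(ι, ℂ), (∀ k, ξ k ∈ S) ∧ TraceNormTendsto ξ ρ}

/-- The standard robustness with respect to the set `F` of free states
(`∞` if no decomposition exists). -/
def standardRobustness {ι : Type} [DecidableEq ι] (F : Set (ℓ²(ι, ℂ) →L[ℂ] ℓ²(ι, ℂ)))
    (ρ : ℓ²(ι, ℂ) →L[ℂ] ℓ²(ι, ℂ)) : ℝ≥0∞ :=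
  sInf {r | ∃ t : ℝ, 0 ≤ t ∧ r = ENNReal.ofReal (1 + t) ∧
    ∃ σ ∈ F, ((1 + t : ℝ) : ℂ)⁻¹ • (ρ + (t : ℂ) • σ) ∈ F}

/-- The (lower semicontinuous) generalized robustness with respect to the set `F` of free states:
the infimum of `1 + t` such that `(ξ k + t τ k) / (1 + t)` is free for all `k`, for some density
operators `τ k` and some sequence of bounded operators `ξ k` converging to `ρ` in trace norm. -/
def generalizedRobustness {ι : Type} [DecidableEq ι] (F : Set (ℓ²(ι, ℂ) →L[ℂ] ℓ²(ι, ℂ)))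
    (ρ : ℓ²(ι, ℂ) →L[ℂ] ℓ²(ι, ℂ)) : ℝ≥0∞ :=
  sInf {r | ∃ t : ℝ, 0 ≤ t ∧ r = ENNReal.ofReal (1 + t) ∧
    ∃ ξ τ : ℕ → ℓ²(ι, ℂ) →L[ℂ] ℓ²(ι, ℂ), TraceNormTendsto ξ ρ ∧
      ∀ k, τ k ∈ densityOperators ι ∧ ((1 + t : ℝ) : ℂ)⁻¹ • (ξ k + (t : ℂ) • τ k) ∈ F}

/-- The single-party space `H_A = H_B`, with orthonormal basis `|n⟩`, `n ≥ 1`. -/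
abbrev HA : Type := ℓ²(ℕ+, ℂ)

/-- The bipartite space `H_A ⊗ H_B`, realised as `ℓ²(ℕ+ × ℕ+)` with `|n⟩ ⊗ |m⟩ = |(n, m)⟩`. -/
abbrev HAB : Type := ℓ²(ℕ+ × ℕ+, ℂ)

/-- `Ψ = ψ ⊗ φ`: the coordinates satisfy `Ψ (n, m) = ψ n * φ m`. -/
def IsTensor (Ψ : HAB) (ψ φ : HA) : Prop := ∀ n m : ℕ+, Ψ (n, m) = ψ n * φ m

/-- The pure product states `|Ψ⟩⟨Ψ|`, `Ψ = ψ ⊗ φ` a unit vector. -/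
def productStates : Set (HAB →L[ℂ] HAB) :=
  {P | ∃ (Ψ : HAB) (ψ φ : HA), ‖Ψ‖ = 1 ∧ IsTensor Ψ ψ φ ∧ P = InnerProductSpace.rankOne ℂ Ψ Ψ}

/-- The separable states: the trace-norm closed convex hull of the pure product states. -/
def separableStates : Set (HAB →L[ℂ] HAB) := traceNormClosure (convexHull ℝ productStates)

/-- Matrix elements of the partial transpose (on the second factor):
`⟨a b| X^Γ |c d⟩ = ⟨a d| X |c b⟩`. -/
def partialTransposeMatrix (X : HAB →L[ℂ] HAB) (p q : ℕ+ × ℕ+) : ℂ :=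
  ⟪ket (p.1, q.2), X (ket (q.1, p.2))⟫_ℂ

/-- The partial transpose `X^Γ`. -/
def partialTranspose (X : HAB →L[ℂ] HAB) : HAB →L[ℂ] HAB := opOfMatrix (partialTransposeMatrix X)

/-- The entanglement negativity `(‖ρ^Γ‖₁ - 1) / 2`. -/
def negativity (ρ : HAB →L[ℂ] HAB) : EReal := ((traceNorm (partialTranspose ρ) : EReal) - 1) / 2

/-- Matrix elements `1 / (n - m)` (and `0` on the diagonal) of the Hilbert operator `H_{-1}`. -/
def hilbertMatrix (n m : ℕ+) : ℂ := if n = m then 0 else 1 / (((n : ℕ) : ℂ) - ((m : ℕ) : ℂ))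

/-- The Hilbert operator `H_{-1}`. -/
def hilbertOperator : HA →L[ℂ] HA := opOfMatrix hilbertMatrix

/-- The weights `1 / (√n ln(n+1))`. -/
def weight (n : ℕ+) : ℝ := 1 / (Real.sqrt (n : ℕ) * Real.log ((n : ℕ) + 1))

/-- Matrix elements of the diagonal operator `D`. -/
def weightMatrix (n m : ℕ+) : ℂ := if n = m then (weight n : ℂ) else 0

/-- The diagonal operator `D = ∑ₙ 1 / (√n ln(n+1)) |n⟩⟨n|`. -/
def weightOperator : HA →L[ℂ] HA := opOfMatrix weightMatrix

/-- The normalization constant `c = Tr D² = ∑ₙ 1 / (n ln(n+1)²)`. -/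
def normConst : ℝ := ∑' n : ℕ+, weight n ^ 2

/-- `ω_± = c⁻¹ D (1 ± (i/π) H_{-1}) D`, the sign being `s = ±1`. -/
def omega (s : ℤˣ) : HA →L[ℂ] HA :=
  (normConst : ℂ)⁻¹ •
    (weightOperator * (1 + (((s : ℤ) : ℂ) * (Complex.I / (Real.pi : ℂ))) • hilbertOperator) *
      weightOperator)

/-- Matrix elements of `∑_{n,m} ω_{n,m} |nn⟩⟨mm|`. -/
def rhoMatrix (s : ℤˣ) (p q : ℕ+ × ℕ+) : ℂ :=
  if p.1 = p.2 ∧ q.1 = q.2 then ⟪ket p.1, omega s (ket q.1)⟫_ℂ else 0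

/-- The bipartite operators `ρ_± = ∑_{n,m} (ω_±)_{n,m} |nn⟩⟨mm|`. -/
def rho (s : ℤˣ) : HAB →L[ℂ] HAB := opOfMatrix (rhoMatrix s)

end

/-
Hilbert's inequality `‖H₋₁‖ ≤ π` holds because `H₋₁` is the Toeplitz operator of the sawtooth
`-2πi B₁`, which is bounded by `π`. Hence `1 ± (i/π) H₋₁` is positive, and `ω_±` and `ρ_±` are
states.

The partial transpose of the maximally correlated operator `∑ ωₙₘ |nn⟩⟨mm|` is a weighted swap
`|nm⟩ ↦ ωₘₙ |mn⟩`, so its trace norm is the `ℓ¹` norm of the entries of `ω`. For `ω_±` this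
diverges: the entries `1 / |m - n|` with `n < m ≤ 2 n` contribute a factor `ln n` to the `n`-th
column, and `∑ 1 / (n ln n)` diverges. The `ℓ¹` norm of the block `|nn⟩⟨mm|` is also at most `1` on
product states, by the arithmetic-geometric mean inequality, hence on separable states, because it
is convex and lower semicontinuous. So no separable `σ` and `τ` satisfy `ρ_± + λ σ = (1 + λ) τ`.

In the average of `ρ_+` and `ρ_-` the terms with `H₋₁` cancel, and what remains is a mixture of the
product states `|nn⟩⟨nn|`; this bounds the generalized robustness by `2`.
-/

section Coordinates

variable {ι : Type} [DecidableEq ι]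

lemma hasSum_norm_sq {ι : Type*} (f : ℓ²(ι, ℂ)) : HasSum (fun i => ‖f i‖ ^ 2) (‖f‖ ^ 2) := by
  simpa using lp.hasSum_norm (p := 2) (by norm_num) f

lemma ket_apply (i j : ι) : ket i j = if j = i then 1 else 0 := by
  rw [ket, lp.single_apply, Pi.single_apply]

lemma norm_ket (i : ι) : ‖ket i‖ = 1 := by
  rw [ket, lp.norm_single (by norm_num), norm_one]

lemma inner_ket_left (i : ι) (f : ℓ²(ι, ℂ)) : ⟪ket i, f⟫_ℂ = f i := by
  rw [ket, lp.inner_single_left, RCLike.inner_apply, map_one, mul_one]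

lemma inner_ket_right (i : ι) (f : ℓ²(ι, ℂ)) : ⟪f, ket i⟫_ℂ = star (f i) := by
  rw [← inner_conj_symm, inner_ket_left]
  rfl

lemma orthonormal_ket : Orthonormal ℂ (ket : ι → ℓ²(ι, ℂ)) := by
  rw [orthonormal_iff_ite]
  intro i j
  rw [inner_ket_left, ket_apply]

lemma ext_inner_ket {f g : ℓ²(ι, ℂ)} (h : ∀ i, ⟪ket i, f⟫_ℂ = ⟪ket i, g⟫_ℂ) : f = g := by
  ext i
  rw [← inner_ket_left, h, inner_ket_left]

lemma clm_ext_ket {F : Type*} [NormedAddCommGroup F] [NormedSpace ℂ F]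
    {S T : ℓ²(ι, ℂ) →L[ℂ] F} (h : ∀ i, S (ket i) = T (ket i)) : S = T := by
  refine lp.ext_continuousLinearMap (by norm_num) fun i => ?_
  ext
  exact h i

lemma norm_apply_ket_le {F : Type*} [NormedAddCommGroup F] [NormedSpace ℂ F]
    (T : ℓ²(ι, ℂ) →L[ℂ] F) (i : ι) : ‖T (ket i)‖ ≤ ‖T‖ := by
  simpa only [norm_ket, mul_one] using T.le_opNorm (ket i)

lemma HasMatrix.ext {S T : ℓ²(ι, ℂ) →L[ℂ] ℓ²(ι, ℂ)} {a : ι → ι → ℂ}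
    (hS : HasMatrix S a) (hT : HasMatrix T a) : S = T :=
  clm_ext_ket fun j => ext_inner_ket fun i => (hS i j).trans (hT i j).symm

lemma HasMatrix.opOfMatrix_eq {T : ℓ²(ι, ℂ) →L[ℂ] ℓ²(ι, ℂ)} {a : ι → ι → ℂ}
    (hT : HasMatrix T a) : opOfMatrix a = T := by
  have h : ∃ T : ℓ²(ι, ℂ) →L[ℂ] ℓ²(ι, ℂ), HasMatrix T a := ⟨T, hT⟩
  rw [opOfMatrix, dif_pos h]
  exact h.choose_spec.ext hT

lemma HasMatrix.opOfMatrix {T : ℓ²(ι, ℂ) →L[ℂ] ℓ²(ι, ℂ)} {a : ι → ι → ℂ}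
    (hT : HasMatrix T a) : HasMatrix (opOfMatrix a) a :=
  hT.opOfMatrix_eq.symm ▸ hT

lemma HasMatrix.isSelfAdjoint {T : ℓ²(ι, ℂ) →L[ℂ] ℓ²(ι, ℂ)} {a : ι → ι → ℂ}
    (hT : HasMatrix T a) (ha : ∀ i j, star (a j i) = a i j) : IsSelfAdjoint T := by
  refine HasMatrix.ext (a := a) (fun i j => ?_) hT
  rw [ContinuousLinearMap.star_eq_adjoint, ContinuousLinearMap.adjoint_inner_right,
    ← inner_conj_symm, hT]
  exact ha i j

section OrthonormalEmbedding

variable {F : Type*} [NormedAddCommGroup F] [InnerProductSpace ℂ F] [CompleteSpace F]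
  {v : ι → F} (hv : Orthonormal ℂ v)

/-- The isometric embedding `|i⟩ ↦ v i` of `ℓ²(ι)` determined by an orthonormal family `v`, as a
continuous linear map, so that it has an adjoint. -/
noncomputable def orthonormalEmbedding : ℓ²(ι, ℂ) →L[ℂ] F :=
  hv.orthogonalFamily.linearIsometry.toContinuousLinearMap

lemma orthonormalEmbedding_ket (i : ι) : orthonormalEmbedding hv (ket i) = v i :=
  (hv.orthogonalFamily.linearIsometry_apply_single (1 : ℂ)).trans (one_smul ℂ _)

omit [DecidableEq ι] in
lemma norm_orthonormalEmbedding_le : ‖orthonormalEmbedding hv‖ ≤ 1 :=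
  LinearIsometry.norm_toContinuousLinearMap_le _

end OrthonormalEmbedding

/-- The bounded operator on `ℓ²(ι)` that is diagonal in the standard basis, with the bounded family
`a` on the diagonal. -/
noncomputable def diagOp (a : ℓ^∞(ι, ℂ)) : ℓ²(ι, ℂ) →L[ℂ] ℓ²(ι, ℂ) :=
  lp.holderL 2 (fun _ => ContinuousLinearMap.mul ℂ ℂ) (K := 1) (fun _ => by simp) a

omit [DecidableEq ι] in
lemma diagOp_apply (a : ℓ^∞(ι, ℂ)) (f : ℓ²(ι, ℂ)) (i : ι) : diagOp a f i = a i * f i := rfl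

lemma diagOp_ket (a : ℓ^∞(ι, ℂ)) (i : ι) : diagOp a (ket i) = a i • ket i := by
  ext j
  rw [diagOp_apply, lp.coeFn_smul, Pi.smul_apply, ket_apply, smul_eq_mul]
  split_ifs with h
  · rw [h]
  · rw [mul_zero, mul_zero]

omit [DecidableEq ι] in
lemma isPositive_diagOp {a : ℓ^∞(ι, ℂ)} (ha : ∀ i, 0 ≤ a i) : (diagOp a).IsPositive := by
  rw [ContinuousLinearMap.isPositive_iff_complex]
  intro f
  have h : 0 ≤ ⟪diagOp a f, f⟫_ℂ := by
    rw [lp.inner_eq_tsum]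
    refine tsum_nonneg fun i => ?_
    rw [diagOp_apply, RCLike.inner_apply, map_mul, (ha i).isSelfAdjoint.conj_eq, mul_left_comm]
    exact mul_nonneg (ha i) (RCLike.mul_conj (f i) ▸ by positivity)
  exact ⟨Complex.ext rfl (Complex.nonneg_iff.1 h).2, (Complex.nonneg_iff.1 h).1⟩

lemma hasMatrix_diagOp (a : ℓ^∞(ι, ℂ)) :
    HasMatrix (diagOp a) fun i j => if i = j then a i else 0 := by
  intro i j
  rw [diagOp_ket, inner_smul_right, inner_ket_left, ket_apply, mul_ite, mul_one, mul_zero]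
  exact ite_congr rfl (fun h => by rw [h]) fun _ => rfl

end Coordinates

section TraceNorm

lemma inner_star_mul_self_apply {E : Type*} [NormedAddCommGroup E]
    [InnerProductSpace ℂ E] [CompleteSpace E] (T : E →L[ℂ] E) (x y : E) :
    ⟪x, (star T * T) y⟫_ℂ = ⟪T x, T y⟫_ℂ := by
  rw [mul_apply_eq_comp, ContinuousLinearMap.star_eq_adjoint,
    ContinuousLinearMap.adjoint_inner_right]

section OpAbs

variable {E : Type} [NormedAddCommGroup E] [InnerProductSpace ℂ E] [CompleteSpace E]

lemma opAbs_eq_of_isPositive {T B : E →L[ℂ] E} (hB : B.IsPositive)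
    (h : star T * T = star B * B) : opAbs T = B := by
  rw [opAbs, CFC.abs, h, ← CFC.abs,
    CFC.abs_of_nonneg B (ContinuousLinearMap.nonneg_iff_isPositive B |>.2 hB)]

lemma norm_opAbs (T : E →L[ℂ] E) : ‖opAbs T‖ = ‖T‖ := CFC.norm_abs

lemma exists_opAbs_eq_star_mul_self (T : E →L[ℂ] E) : ∃ R : E →L[ℂ] E, opAbs T = star R * R :=
  CStarAlgebra.nonneg_iff_eq_star_mul_self.1 (CFC.abs_nonneg T)

end OpAbs

variable {ι : Type} [DecidableEq ι]

lemma norm_sq_le_of_hasSum {F : Type*} [NormedAddCommGroup F] [InnerProductSpace ℂ F]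
    [CompleteSpace F] {R : ℓ²(ι, ℂ) →L[ℂ] F} {C : ℝ}
    (hR : HasSum (fun i => ‖R (ket i)‖ ^ 2) C) : ‖R‖ ^ 2 ≤ C := by
  have hC : 0 ≤ C := hR.nonneg fun _ => sq_nonneg _
  rw [← Real.le_sqrt (norm_nonneg R) hC]
  have hadj : ‖ContinuousLinearMap.adjoint R‖ ≤ √C := by
    refine ContinuousLinearMap.opNorm_le_bound _ (Real.sqrt_nonneg C) fun y => ?_
    refine (sq_le_sq₀ (norm_nonneg _) (by positivity)).1 ?_
    rw [mul_pow, Real.sq_sqrt hC]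
    refine hasSum_le (fun i => ?_) (hasSum_norm_sq _) (hR.mul_right (‖y‖ ^ 2))
    rw [← inner_ket_left, ContinuousLinearMap.adjoint_inner_right, ← mul_pow]
    gcongr
    exact norm_inner_le_norm _ _
  rwa [LinearIsometryEquiv.norm_map] at hadj

lemma enorm_le_traceNorm (T : ℓ²(ι, ℂ) →L[ℂ] ℓ²(ι, ℂ)) : ‖T‖ₑ ≤ traceNorm T := by
  obtain ⟨R, hR⟩ := exists_opAbs_eq_star_mul_self T
  have hT : ‖T‖ = ‖R‖ ^ 2 := by rw [← norm_opAbs, hR, CStarRing.norm_star_mul_self, sq]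
  have htrace : traceNorm T = ∑' i, ENNReal.ofReal (‖R (ket i)‖ ^ 2) := by
    refine tsum_congr fun i => ?_
    rw [hR, inner_star_mul_self_apply]
    exact congrArg ENNReal.ofReal (inner_self_eq_norm_sq (𝕜 := ℂ) _)
  rw [htrace]
  by_cases htop : ∑' i, ENNReal.ofReal (‖R (ket i)‖ ^ 2) = ⊤
  · exact htop ▸ le_top
  have hsum : Summable fun i => ‖R (ket i)‖ ^ 2 := by
    simpa using ENNReal.summable_toReal htop
  rw [← ENNReal.ofReal_tsum_of_nonneg (fun _ => sq_nonneg _) hsum, ← ofReal_norm, hT]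
  exact ENNReal.ofReal_le_ofReal (norm_sq_le_of_hasSum hsum.hasSum)

lemma TraceNormTendsto.tendsto {ξ : ℕ → ℓ²(ι, ℂ) →L[ℂ] ℓ²(ι, ℂ)} {ρ : ℓ²(ι, ℂ) →L[ℂ] ℓ²(ι, ℂ)}
    (h : TraceNormTendsto ξ ρ) : Tendsto ξ atTop (𝓝 ρ) := by
  rw [tendsto_iff_edist_tendsto_0]
  refine tendsto_of_tendsto_of_tendsto_of_le_of_le tendsto_const_nhds h (fun _ => zero_le) ?_
  exact fun k => (edist_eq_enorm_sub _ _).trans_le (enorm_le_traceNorm _)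

lemma traceNormClosure_subset_closure (S : Set (ℓ²(ι, ℂ) →L[ℂ] ℓ²(ι, ℂ))) :
    traceNormClosure S ⊆ closure S := fun _ ⟨_, hξ, hlim⟩ =>
  mem_closure_of_tendsto hlim.tendsto (Eventually.of_forall hξ)

lemma traceNorm_eq_tsum_of_orthogonal {T : ℓ²(ι, ℂ) →L[ℂ] ℓ²(ι, ℂ)}
    (hT : Pairwise fun i j => ⟪T (ket i), T (ket j)⟫_ℂ = 0) :
    traceNorm T = ∑' i, ‖T (ket i)‖ₑ := by
  let a : ℓ^∞(ι, ℂ) := ⟨fun i => (‖T (ket i)‖ : ℂ), memℓp_infty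
    ⟨‖T‖, Set.forall_mem_range.2 fun i => by simpa using norm_apply_ket_le T i⟩⟩
  have ha (i : ι) : a i = (‖T (ket i)‖ : ℂ) := rfl
  have habs : opAbs T = diagOp a := by
    refine opAbs_eq_of_isPositive
      (isPositive_diagOp fun i => Complex.zero_le_real.2 (norm_nonneg _)) ?_
    refine clm_ext_ket fun j => ext_inner_ket fun i => ?_
    rw [inner_star_mul_self_apply, inner_star_mul_self_apply, diagOp_ket, diagOp_ket,
      inner_smul_left, inner_smul_right, inner_ket_left, ket_apply]
    obtain rfl | hij := eq_or_ne i j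
    · rw [if_pos rfl, mul_one, ha, Complex.conj_ofReal, ← sq]
      exact inner_self_eq_norm_sq_to_K _
    · rw [if_neg hij, mul_zero, mul_zero, hT hij]
  refine tsum_congr fun i => ?_
  rw [habs, diagOp_ket, inner_smul_right, inner_ket_left, ket_apply, if_pos rfl, mul_one, ha,
    Complex.ofReal_re, ofReal_norm]

lemma traceNorm_eq_tsum_of_diagonal {T : ℓ²(ι, ℂ) →L[ℂ] ℓ²(ι, ℂ)} {a : ι → ℂ}
    (hT : ∀ i, T (ket i) = a i • ket i) : traceNorm T = ∑' i, ‖a i‖ₑ := by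
  rw [traceNorm_eq_tsum_of_orthogonal fun i j hij => ?_]
  · simp_rw [hT, enorm_smul, ← ofReal_norm (ket _), norm_ket, ENNReal.ofReal_one, mul_one]
  · simp only [hT, inner_smul_left, inner_smul_right, orthonormal_ket.2 hij, mul_zero]

lemma traceNorm_zero : traceNorm (0 : ℓ²(ι, ℂ) →L[ℂ] ℓ²(ι, ℂ)) = 0 := by
  rw [traceNorm_eq_tsum_of_diagonal (a := 0) fun i => by simp]
  simp

lemma traceNormTendsto_const (ρ : ℓ²(ι, ℂ) →L[ℂ] ℓ²(ι, ℂ)) : TraceNormTendsto (fun _ => ρ) ρ := by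
  simp only [TraceNormTendsto, sub_self, traceNorm_zero, tendsto_const_nhds]

end TraceNorm

section TraceNormClosure

variable {ι : Type} [DecidableEq ι]

lemma mem_traceNormClosure_of_tendsto {α : Type*} {l : Filter α} [l.NeBot]
    {S : Set (ℓ²(ι, ℂ) →L[ℂ] ℓ²(ι, ℂ))} {ξ : α → ℓ²(ι, ℂ) →L[ℂ] ℓ²(ι, ℂ)}
    {ρ : ℓ²(ι, ℂ) →L[ℂ] ℓ²(ι, ℂ)} (hξ : ∀ a, ξ a ∈ S)
    (h : Tendsto (fun a => traceNorm (ξ a - ρ)) l (𝓝 0)) : ρ ∈ traceNormClosure S := by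
  have hclose (k : ℕ) : ∃ a, traceNorm (ξ a - ρ) < (k : ℝ≥0∞)⁻¹ :=
    (h.eventually_lt_const (ENNReal.inv_pos.2 (ENNReal.natCast_ne_top k))).exists
  choose a ha using hclose
  exact ⟨fun k => ξ (a k), fun k => hξ (a k),
    tendsto_of_tendsto_of_tendsto_of_le_of_le tendsto_const_nhds
      ENNReal.tendsto_inv_nat_nhds_zero (fun _ => zero_le) fun k => (ha k).le⟩

lemma sum_add_one_sub_smul_mem_convexHull {ι E : Type*} [AddCommGroup E] [Module ℝ E] {S : Set E}
    {x : ι → E} (hx : ∀ i, x i ∈ S) {p : ι → ℝ} (hp : ∀ i, 0 ≤ p i) {I : Finset ι}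
    (hI : ∑ i ∈ I, p i ≤ 1) (i₀ : ι) :
    ∑ i ∈ I, p i • x i + (1 - ∑ i ∈ I, p i) • x i₀ ∈ convexHull ℝ S := by
  have h := (convex_convexHull ℝ S).sum_mem (t := I.insertNone)
    (w := fun o => o.elim (1 - ∑ i ∈ I, p i) p) (z := fun o => o.elim (x i₀) x) ?_ ?_ ?_
  · simpa [Finset.sum_insertNone, add_comm] using h
  · rintro (_ | i) _
    exacts [sub_nonneg.2 hI, hp i]
  · simp [Finset.sum_insertNone]
  · rintro (_ | i) _
    exacts [subset_convexHull ℝ S (hx i₀), subset_convexHull ℝ S (hx i)]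

lemma rankOne_ket_apply_ket (i j : ι) :
    InnerProductSpace.rankOne ℂ (ket i) (ket i) (ket j) = if i = j then ket j else 0 := by
  rw [InnerProductSpace.rankOne_apply, inner_ket_left, ket_apply]
  split_ifs with h
  · rw [h, one_smul]
  · exact zero_smul _ _

lemma traceNorm_sum_rankOne_ket_sub_le {T : ℓ²(ι, ℂ) →L[ℂ] ℓ²(ι, ℂ)} {p : ι → ℝ}
    (hT : ∀ i, T (ket i) = (p i : ℂ) • ket i) (I : Finset ι) (i₀ : ι) (r : ℝ) :
    traceNorm (∑ i ∈ I, p i • InnerProductSpace.rankOne ℂ (ket i) (ket i) +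
      r • InnerProductSpace.rankOne ℂ (ket i₀) (ket i₀) - T) ≤
        ‖r‖ₑ + ∑' j : {j // j ∉ I}, ‖p j‖ₑ := by
  have hdiag (j : ι) : (∑ i ∈ I, p i • InnerProductSpace.rankOne ℂ (ket i) (ket i) +
      r • InnerProductSpace.rankOne ℂ (ket i₀) (ket i₀) - T) (ket j) =
        (((if i₀ = j then r else 0) - if j ∈ I then 0 else p j : ℝ) : ℂ) • ket j := by
    simp only [sub_apply, add_apply, sum_apply, smul_apply, rankOne_ket_apply_ket, hT, smul_ite,
      smul_zero, Finset.sum_ite_eq']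
    split_ifs <;> push_cast <;> module
  rw [traceNorm_eq_tsum_of_diagonal hdiag, ← tsum_ite_eq i₀ fun _ => ‖r‖ₑ]
  refine (ENNReal.tsum_le_tsum fun j => ?_).trans_eq (ENNReal.tsum_add.trans
    (congrArg _ (tsum_subtype {j | j ∉ I} fun j => ‖p j‖ₑ).symm))
  rw [← ofReal_norm, Complex.norm_real, ofReal_norm]
  refine enorm_sub_le.trans_eq ?_
  simp [Set.indicator_apply, apply_ite enorm, eq_comm]

lemma mem_traceNormClosure_convexHull_of_diagonal {S : Set (ℓ²(ι, ℂ) →L[ℂ] ℓ²(ι, ℂ))}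
    (hS : ∀ i, InnerProductSpace.rankOne ℂ (ket i) (ket i) ∈ S)
    {T : ℓ²(ι, ℂ) →L[ℂ] ℓ²(ι, ℂ)} {p : ι → ℝ} (hp : ∀ i, 0 ≤ p i) (hsum : HasSum p 1)
    (hT : ∀ i, T (ket i) = (p i : ℂ) • ket i) : T ∈ traceNormClosure (convexHull ℝ S) := by
  obtain ⟨i₀⟩ : Nonempty ι := by
    by_contra hι
    have := not_nonempty_iff.1 hι
    exact one_ne_zero (hsum.unique hasSum_empty)
  have hfin : ∑' i, ‖p i‖ₑ ≠ ⊤ := by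
    simpa only [Real.enorm_of_nonneg (hp _)] using hsum.summable.tsum_ofReal_ne_top
  have hdefect : Tendsto (fun I => 1 - ∑ i ∈ I, p i) atTop (𝓝 0) := by
    rw [HasSum, SummationFilter.unconditional_filter] at hsum
    simpa only [sub_self] using hsum.const_sub 1
  -- The defect `1 - ∑ i ∈ I, p i` of the truncation to `I` is put on the fixed vertex `|i₀⟩⟨i₀|`.
  refine mem_traceNormClosure_of_tendsto (l := atTop) (fun I =>
    sum_add_one_sub_smul_mem_convexHull hS hp (sum_le_hasSum I (fun i _ => hp i) hsum) i₀) ?_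
  refine tendsto_of_tendsto_of_tendsto_of_le_of_le tendsto_const_nhds ?_ (fun _ => zero_le)
    fun I => traceNorm_sum_rankOne_ket_sub_le hT I i₀ _
  simpa only [enorm_zero, add_zero] using
    hdefect.enorm.add (ENNReal.tendsto_tsum_compl_atTop_zero hfin)

end TraceNormClosure

section Robustness

lemma generalizedRobustness_le_of_mem {ι : Type} [DecidableEq ι]
    {F : Set (ℓ²(ι, ℂ) →L[ℂ] ℓ²(ι, ℂ))} {ρ τ : ℓ²(ι, ℂ) →L[ℂ] ℓ²(ι, ℂ)} {t : ℝ} (ht : 0 ≤ t)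
    (hτ : τ ∈ densityOperators ι) (h : ((1 + t : ℝ) : ℂ)⁻¹ • (ρ + (t : ℂ) • τ) ∈ F) :
    generalizedRobustness F ρ ≤ ENNReal.ofReal (1 + t) :=
  sInf_le ⟨t, ht, rfl, fun _ => ρ, fun _ => τ, traceNormTendsto_const ρ, fun _ => ⟨hτ, h⟩⟩

lemma negativity_eq_top {ρ : HAB →L[ℂ] HAB} (h : traceNorm (partialTranspose ρ) = ⊤) :
    negativity ρ = ⊤ := by
  have htop : (⊤ : EReal) - 1 = ⊤ := EReal.top_sub_coe 1
  rw [negativity, h, EReal.coe_ennreal_top, htop]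
  exact EReal.top_div_of_pos_ne_top (by norm_num) (EReal.coe_ne_top 2)

lemma rankOne_ket_mem_productStates (p : ℕ+ × ℕ+) :
    InnerProductSpace.rankOne ℂ (ket p) (ket p) ∈ productStates := by
  refine ⟨_, ket p.1, ket p.2, norm_ket p, fun n m => ?_, rfl⟩
  simp only [ket_apply, Prod.ext_iff, ite_and, mul_ite, mul_one, mul_zero]
  split_ifs <;> rfl

lemma mem_separableStates_of_diagonal {T : HAB →L[ℂ] HAB} {p : ℕ+ × ℕ+ → ℝ} (hp : ∀ q, 0 ≤ p q)
    (hsum : HasSum p 1) (hT : ∀ q, T (ket q) = (p q : ℂ) • ket q) : T ∈ separableStates :=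
  mem_traceNormClosure_convexHull_of_diagonal rankOne_ket_mem_productStates hp hsum hT

/-- The `ℓ¹` norm of the coefficients of `X` in its block `|nn⟩⟨mm|`. It is at most `1` on
separable states, which makes it a witness of entanglement. -/
noncomputable def diagBlockNorm (X : HAB →L[ℂ] HAB) : ℝ≥0∞ :=
  ∑' p : ℕ+ × ℕ+, ‖⟪ket (p.1, p.1), X (ket (p.2, p.2))⟫_ℂ‖ₑ

lemma diagBlockNorm_add_le (X Y : HAB →L[ℂ] HAB) :
    diagBlockNorm (X + Y) ≤ diagBlockNorm X + diagBlockNorm Y := by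
  rw [diagBlockNorm, diagBlockNorm, diagBlockNorm, ← ENNReal.tsum_add]
  refine ENNReal.tsum_le_tsum fun p => ?_
  rw [add_apply, inner_add_right]
  exact enorm_add_le _ _

lemma diagBlockNorm_smul (c : ℂ) (X : HAB →L[ℂ] HAB) :
    diagBlockNorm (c • X) = ‖c‖ₑ * diagBlockNorm X := by
  simp only [diagBlockNorm, smul_apply, inner_smul_right, enorm_mul, ENNReal.tsum_mul_left]

lemma lowerSemicontinuous_diagBlockNorm : LowerSemicontinuous diagBlockNorm :=
  lowerSemicontinuous_tsum fun p => Continuous.lowerSemicontinuous <|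
    ((innerSL ℂ (ket (p.1, p.1))).continuous.comp
      (ContinuousLinearMap.apply ℂ HAB (ket (p.2, p.2))).continuous).enorm

lemma convex_setOf_diagBlockNorm_le_one : Convex ℝ {X | diagBlockNorm X ≤ 1} := by
  intro X hX Y hY a b ha hb hab
  calc diagBlockNorm ((a : ℂ) • X + (b : ℂ) • Y)
      ≤ ENNReal.ofReal a * diagBlockNorm X + ENNReal.ofReal b * diagBlockNorm Y := by
        refine (diagBlockNorm_add_le _ _).trans_eq ?_
        simp only [diagBlockNorm_smul, ← ofReal_norm, Complex.norm_of_nonneg ha,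
          Complex.norm_of_nonneg hb]
    _ ≤ ENNReal.ofReal a * 1 + ENNReal.ofReal b * 1 := by
        gcongr
        exacts [hX, hY]
    _ = 1 := by rw [mul_one, mul_one, ← ENNReal.ofReal_add ha hb, hab, ENNReal.ofReal_one]

lemma diagBlockNorm_le_one_of_mem_productStates {P : HAB →L[ℂ] HAB} (hP : P ∈ productStates) :
    diagBlockNorm P ≤ 1 := by
  obtain ⟨Ψ, ψ, φ, hΨ, hten, rfl⟩ := hP
  have hsq : HasSum (fun p => ‖Ψ p‖ ^ 2) 1 := by
    simpa only [hΨ, one_pow] using hasSum_norm_sq Ψ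
  have hmean : HasSum (fun p => (‖Ψ p‖ ^ 2 + ‖Ψ p.swap‖ ^ 2) / 2) 1 := by
    simpa using (hsq.add ((Equiv.prodComm ℕ+ ℕ+).hasSum_iff.2 hsq)).div_const 2
  have hentry (p : ℕ+ × ℕ+) :
      ‖⟪ket (p.1, p.1), InnerProductSpace.rankOne ℂ Ψ Ψ (ket (p.2, p.2))⟫_ℂ‖ =
        ‖Ψ p‖ * ‖Ψ p.swap‖ := by
    rw [InnerProductSpace.rankOne_apply, inner_smul_right, inner_ket_left, inner_ket_right,
      norm_mul, norm_star, hten, hten, hten p.1 p.2, Prod.swap, hten]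
    simp only [norm_mul]
    ring
  calc diagBlockNorm (InnerProductSpace.rankOne ℂ Ψ Ψ)
      ≤ ∑' p, ENNReal.ofReal ((‖Ψ p‖ ^ 2 + ‖Ψ p.swap‖ ^ 2) / 2) := by
        refine ENNReal.tsum_le_tsum fun p => ?_
        rw [← ofReal_norm, hentry]
        exact ENNReal.ofReal_le_ofReal (by linarith [two_mul_le_add_sq ‖Ψ p‖ ‖Ψ p.swap‖])
    _ = 1 := by
        rw [← ENNReal.ofReal_tsum_of_nonneg (fun _ => by positivity) hmean.summable,
          hmean.tsum_eq, ENNReal.ofReal_one]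

lemma diagBlockNorm_le_one_of_mem_separableStates {σ : HAB →L[ℂ] HAB} (hσ : σ ∈ separableStates) :
    diagBlockNorm σ ≤ 1 := by
  have hclosed : IsClosed {X | diagBlockNorm X ≤ 1} :=
    lowerSemicontinuous_diagBlockNorm.isClosed_preimage 1
  refine closure_minimal (convexHull_min (fun P => ?_) convex_setOf_diagBlockNorm_le_one) hclosed
    (traceNormClosure_subset_closure _ hσ)
  exact diagBlockNorm_le_one_of_mem_productStates

lemma standardRobustness_separableStates_eq_top {ρ : HAB →L[ℂ] HAB} (hρ : diagBlockNorm ρ = ⊤) :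
    standardRobustness separableStates ρ = ⊤ := by
  refine sInf_eq_top.2 ?_
  rintro _ ⟨t, ht, -, σ, hσ, hmix⟩
  have hscale : ((1 + t : ℝ) : ℂ) ≠ 0 := Complex.ofReal_ne_zero.2 (by positivity)
  obtain ⟨τ, hτ, rfl⟩ : ∃ τ ∈ separableStates, ρ = ((1 + t : ℝ) : ℂ) • τ + (-t : ℂ) • σ :=
    ⟨_, hmix, by rw [smul_inv_smul₀ hscale, neg_smul, add_neg_cancel_right]⟩
  have hfin {σ : HAB →L[ℂ] HAB} (hσ : σ ∈ separableStates) : diagBlockNorm σ ≠ ⊤ :=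
    ne_top_of_le_ne_top ENNReal.one_ne_top (diagBlockNorm_le_one_of_mem_separableStates hσ)
  refine absurd hρ (ne_top_of_le_ne_top ?_ (diagBlockNorm_add_le _ _))
  rw [diagBlockNorm_smul, diagBlockNorm_smul]
  exact ENNReal.add_ne_top.2
    ⟨ENNReal.mul_ne_top enorm_ne_top (hfin hτ), ENNReal.mul_ne_top enorm_ne_top (hfin hσ)⟩

end Robustness

section Toeplitz

open MeasureTheory AddCircle

variable {T : ℝ} [Fact (0 < T)]

/-- The isometric embedding `|n⟩ ↦ exp(2πi n x / T)` of `H_A` into `L²` of the circle, onto the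
closed span of the positive frequencies. -/
noncomputable def fourierEmbedding : HA →L[ℂ] Lp ℂ 2 (haarAddCircle (T := T)) :=
  orthonormalEmbedding <| orthonormal_fourier.comp ((↑) : ℕ+ → ℤ) fun _ _ => by simp

lemma fourierEmbedding_ket (n : ℕ+) : fourierEmbedding (T := T) (ket n) = fourierLp 2 (n : ℤ) :=
  orthonormalEmbedding_ket _ n

/-- The Toeplitz operator on `ℓ²(ℕ+)` with symbol `u`: multiplication by `u` on `L²` of the circle,
compressed to the span of the positive frequencies. -/
noncomputable def toeplitz (u : Lp ℂ ∞ (haarAddCircle (T := T))) : HA →L[ℂ] HA :=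
  ContinuousLinearMap.adjoint fourierEmbedding ∘L
    (ContinuousLinearMap.mul ℂ ℂ).holderL haarAddCircle ∞ 2 2 u ∘L fourierEmbedding

lemma inner_ket_toeplitz (u : Lp ℂ ∞ (haarAddCircle (T := T))) (n m : ℕ+) :
    ⟪ket n, toeplitz u (ket m)⟫_ℂ = fourierCoeff u ((n : ℤ) - (m : ℤ)) := by
  rw [toeplitz, ContinuousLinearMap.comp_apply, ContinuousLinearMap.adjoint_inner_right,
    ContinuousLinearMap.comp_apply, fourierEmbedding_ket, fourierEmbedding_ket,
    ContinuousLinearMap.holderL_apply_apply, L2.inner_def, fourierCoeff]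
  refine integral_congr_ae ?_
  filter_upwards [coeFn_fourierLp (T := T) 2 (n : ℤ), coeFn_fourierLp (T := T) 2 (m : ℤ),
    (ContinuousLinearMap.mul ℂ ℂ).coeFn_holder (r := 2) u (fourierLp (T := T) 2 (m : ℤ))]
    with x hn hm hmul
  simp only [hn, hm, hmul, RCLike.inner_apply, ContinuousLinearMap.mul_apply',
    sub_eq_add_neg, fourier_add, fourier_neg, smul_eq_mul, map_mul, Complex.conj_conj]
  ring

lemma norm_toeplitz_le (u : Lp ℂ ∞ (haarAddCircle (T := T))) : ‖toeplitz u‖ ≤ ‖u‖ := by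
  have hV : ‖fourierEmbedding (T := T)‖ ≤ 1 := norm_orthonormalEmbedding_le _
  have hM : ‖(ContinuousLinearMap.mul ℂ ℂ).holderL haarAddCircle ∞ 2 2 u‖ ≤ ‖u‖ :=
    ContinuousLinearMap.opNorm_le_bound _ (norm_nonneg u) fun f => by
      simpa only [ContinuousLinearMap.opNorm_mul, one_mul,
        ContinuousLinearMap.holderL_apply_apply] using
          (ContinuousLinearMap.mul ℂ ℂ).norm_holder_apply_apply_le (r := 2) u f
  calc ‖toeplitz u‖ ≤ 1 * (‖u‖ * 1) := by
        refine (ContinuousLinearMap.opNorm_comp_le _ _).trans ?_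
        refine mul_le_mul ?_ ((ContinuousLinearMap.opNorm_comp_le _ _).trans ?_)
          (norm_nonneg _) zero_le_one
        · rwa [LinearIsometryEquiv.norm_map]
        · gcongr
    _ = ‖u‖ := by rw [one_mul, mul_one]

end Toeplitz

section HilbertInequality

open MeasureTheory AddCircle

lemma measurable_periodizedBernoulli (k : ℕ) : Measurable (periodizedBernoulli k) :=
  ((Polynomial.continuous _).measurable.comp measurable_subtype_coe).comp
    (measurableEquivIco 1 0).measurable

lemma abs_periodizedBernoulli_one_le (x : UnitAddCircle) : |periodizedBernoulli 1 x| ≤ 1 / 2 := by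
  obtain ⟨h0, h1⟩ := (equivIco (1 : ℝ) 0 x).2
  change |bernoulliFun 1 (equivIco 1 0 x)| ≤ 1 / 2
  rw [bernoulliFun_one, abs_le]
  constructor <;> linarith

lemma memLp_periodizedBernoulli_one :
    MemLp ((↑) ∘ periodizedBernoulli 1 : UnitAddCircle → ℂ) ∞ haarAddCircle := by
  refine memLp_top_of_bound ?_ (1 / 2) (ae_of_all _ fun x => ?_)
  · exact (Complex.measurable_ofReal.comp
      (measurable_periodizedBernoulli 1)).aestronglyMeasurable
  · simpa using abs_periodizedBernoulli_one_le x

/-- The Toeplitz operator of the sawtooth `-2πi B₁`, whose `k`-th Fourier coefficient is `1 / k`. -/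
noncomputable def sawtoothToeplitz : HA →L[ℂ] HA :=
  (-(2 * Real.pi * Complex.I)) • toeplitz memLp_periodizedBernoulli_one.toLp

lemma hasMatrix_sawtoothToeplitz : HasMatrix sawtoothToeplitz hilbertMatrix := by
  intro n m
  rw [sawtoothToeplitz, smul_apply, inner_smul_right, inner_ket_toeplitz,
    fourierCoeff_congr_ae memLp_periodizedBernoulli_one.coeFn_toLp,
    fourierCoeff_bernoulli_eq one_ne_zero, hilbertMatrix]
  split_ifs with h
  · simp [h]
  · have hpi : (Real.pi : ℂ) ≠ 0 := Complex.ofReal_ne_zero.2 Real.pi_ne_zero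
    push_cast
    field_simp
    simp

lemma norm_sawtoothToeplitz_le : ‖sawtoothToeplitz‖ ≤ Real.pi := by
  have hu : ‖memLp_periodizedBernoulli_one.toLp‖ ≤ 1 / 2 := by
    have h := Lp.norm_le_of_ae_bound (f := memLp_periodizedBernoulli_one.toLp) one_half_pos.le <|
      memLp_periodizedBernoulli_one.coeFn_toLp.mono fun x hx => by
        rw [hx]
        simpa using abs_periodizedBernoulli_one_le x
    simpa using h
  calc ‖sawtoothToeplitz‖ ≤ 2 * Real.pi * (1 / 2) := by
        rw [sawtoothToeplitz, norm_smul]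
        gcongr
        · simp [abs_of_pos Real.pi_pos]
        · exact (norm_toeplitz_le _).trans hu
    _ = Real.pi := by ring

lemma hasMatrix_hilbertOperator : HasMatrix hilbertOperator hilbertMatrix :=
  hasMatrix_sawtoothToeplitz.opOfMatrix

lemma norm_hilbertOperator_le : ‖hilbertOperator‖ ≤ Real.pi := by
  rw [hilbertOperator, hasMatrix_sawtoothToeplitz.opOfMatrix_eq]
  exact norm_sawtoothToeplitz_le

end HilbertInequality

section Weights

lemma log_natCast_add_one_pos {n : ℕ} (hn : 0 < n) : 0 < Real.log ((n : ℝ) + 1) :=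
  Real.log_pos (lt_add_of_pos_left 1 (Nat.cast_pos.2 hn))

lemma mul_log_two_le_log_two_pow_add_one (k : ℕ) : k * Real.log 2 ≤ Real.log (2 ^ k + 1) := by
  rw [← Real.log_pow]
  exact Real.log_le_log (by positivity) (le_add_of_nonneg_right zero_le_one)

lemma log_two_pow_add_one_le (k : ℕ) : Real.log (2 ^ k + 1) ≤ (k + 1) * Real.log 2 := by
  rw [← Nat.cast_succ, ← Real.log_pow, Nat.succ_eq_add_one, pow_succ, mul_two]
  exact Real.log_le_log (by positivity) (by gcongr; exact one_le_pow₀ one_le_two)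

lemma summable_one_div_mul_log_sq :
    Summable fun n : ℕ => 1 / ((n : ℝ) * Real.log (n + 1) ^ 2) := by
  rw [← summable_condensed_iff_of_nonneg fun n => by positivity]
  · have : 0 < Real.log 2 := Real.log_pos one_lt_two
    refine .of_norm_bounded_eventually_nat
      ((Real.summable_one_div_nat_pow.2 one_lt_two).mul_left (Real.log 2 ^ 2)⁻¹) ?_
    filter_upwards [eventually_gt_atTop 0] with k hk
    rw [Real.norm_of_nonneg (by positivity)]
    push_cast
    calc (2 : ℝ) ^ k * (1 / (2 ^ k * Real.log (2 ^ k + 1) ^ 2))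
        = 1 / Real.log (2 ^ k + 1) ^ 2 := by field_simp
      _ ≤ 1 / (k * Real.log 2) ^ 2 := by
        gcongr
        exact mul_log_two_le_log_two_pow_add_one k
      _ = (Real.log 2 ^ 2)⁻¹ * (1 / k ^ 2) := by field_simp
  · intro m n hm hmn
    have hlog := log_natCast_add_one_pos hm
    gcongr

lemma not_summable_one_div_mul_log :
    ¬ Summable fun n : ℕ => 1 / ((n : ℝ) * Real.log (n + 1)) := by
  have hlog_nonneg (n : ℕ) : 0 ≤ Real.log ((n : ℝ) + 1) :=
    Real.log_nonneg (le_add_of_nonneg_left n.cast_nonneg)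
  rw [← summable_condensed_iff_of_nonneg fun n => by have := hlog_nonneg n; positivity]
  · intro h
    have : 0 < Real.log 2 := Real.log_pos one_lt_two
    refine Real.not_summable_one_div_natCast ((summable_nat_add_iff 1).1 ?_)
    refine .of_nonneg_of_le (fun k => by positivity) (fun k => ?_) (h.mul_left (Real.log 2))
    have hlog : 0 < Real.log ((2 : ℝ) ^ k + 1) := Real.log_pos (by simp)
    push_cast
    calc (1 : ℝ) / (k + 1) = Real.log 2 * (1 / ((k + 1) * Real.log 2)) := by field_simp
      _ ≤ Real.log 2 * (1 / Real.log (2 ^ k + 1)) := by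
        gcongr
        exact log_two_pow_add_one_le k
      _ = Real.log 2 * (2 ^ k * (1 / (2 ^ k * Real.log (2 ^ k + 1)))) := by field_simp
  · intro m n hm hmn
    have hlog := log_natCast_add_one_pos hm
    gcongr

lemma tsum_enorm_one_div_mul_log :
    ∑' n : ℕ+, ‖1 / (((n : ℕ) : ℝ) * Real.log ((n : ℕ) + 1))‖ₑ = ⊤ := by
  by_contra htop
  refine not_summable_one_div_mul_log (summable_pnat_iff_summable_nat.1 (.of_norm ?_))
  simpa only [toReal_enorm] using ENNReal.summable_toReal htop

lemma weight_pos (n : ℕ+) : 0 < weight n :=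
  one_div_pos.2 (mul_pos (Real.sqrt_pos.2 (Nat.cast_pos.2 n.pos)) (log_natCast_add_one_pos n.pos))

lemma weight_sq (n : ℕ+) :
    weight n ^ 2 = 1 / (((n : ℕ) : ℝ) * Real.log ((n : ℕ) + 1) ^ 2) := by
  rw [weight, div_pow, mul_pow, Real.sq_sqrt (by positivity), one_pow]

lemma summable_weight_sq : Summable fun n : ℕ+ => weight n ^ 2 := by
  simp_rw [weight_sq]
  exact summable_pnat_iff_summable_nat.2 summable_one_div_mul_log_sq

lemma normConst_pos : 0 < normConst :=
  summable_weight_sq.tsum_pos (fun _ => sq_nonneg _) 1 (pow_pos (weight_pos 1) 2)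

lemma weight_le (n : ℕ+) : weight n ≤ √normConst :=
  Real.le_sqrt_of_sq_le (summable_weight_sq.le_tsum n fun _ _ => sq_nonneg _)

lemma hasSum_weight_sq_div : HasSum (fun n => weight n ^ 2 / normConst) 1 :=
  div_self normConst_pos.ne' ▸ summable_weight_sq.hasSum.div_const normConst

lemma weight_div_four_le {n m : ℕ+} (h : (m : ℕ) ≤ 2 * n) : weight n / 4 ≤ weight m := by
  have hn : (1 : ℝ) ≤ (n : ℕ) := Nat.one_le_cast.2 n.pos
  have : (0 : ℝ) < (m : ℕ) := Nat.cast_pos.2 m.pos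
  have hmn : ((m : ℕ) : ℝ) ≤ 2 * (n : ℕ) := by exact_mod_cast h
  have hsqrt : √(m : ℕ) ≤ 2 * √(n : ℕ) := by
    rw [Real.sqrt_le_left (by positivity), mul_pow, Real.sq_sqrt (by positivity)]
    linarith
  have hlog : Real.log ((m : ℕ) + 1) ≤ 2 * Real.log ((n : ℕ) + 1) := by
    rw [← Nat.cast_two, ← Real.log_pow]
    exact Real.log_le_log (by positivity) (by nlinarith)
  have hlog_pos := log_natCast_add_one_pos m.pos
  rw [weight, weight, div_div]
  refine one_div_le_one_div_of_le (by positivity) ?_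
  calc √(m : ℕ) * Real.log ((m : ℕ) + 1) ≤ 2 * √(n : ℕ) * (2 * Real.log ((n : ℕ) + 1)) := by
        gcongr
    _ = √(n : ℕ) * Real.log ((n : ℕ) + 1) * 4 := by ring

lemma weight_sq_div_le (n : ℕ+) {j : ℕ} (hj : j < n) :
    weight n ^ 2 / 4 / (j + 1) ≤
      ‖(weight (n + j.succPNat) * weight n : ℂ) * hilbertMatrix (n + j.succPNat) n‖ := by
  have hsub : (((n + j.succPNat : ℕ+) : ℕ) : ℂ) - ((n : ℕ) : ℂ) = ((j + 1 : ℝ) : ℂ) := by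
    simp
  have hne : n + j.succPNat ≠ n := (PNat.lt_add_right n _).ne'
  rw [hilbertMatrix, if_neg hne, hsub, mul_one_div, norm_div, norm_mul, Complex.norm_of_nonneg
    (weight_pos _).le, Complex.norm_of_nonneg (weight_pos _).le, Complex.norm_of_nonneg
    (by positivity), sq, mul_div_right_comm]
  gcongr
  · exact (weight_pos n).le
  · refine weight_div_four_le ?_
    rw [PNat.add_coe, Nat.succPNat_coe]
    lia

/-- The entries `1 / (m - n)` with `n < m ≤ 2 n` already contribute the harmonic sum
`1 + ⋯ + 1 / n ≥ ln (n + 1)` to the `n`-th column. -/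
lemma enorm_one_div_mul_log_le_tsum (n : ℕ+) :
    ‖1 / (((n : ℕ) : ℝ) * Real.log ((n : ℕ) + 1))‖ₑ ≤
      4 * ∑' m, ‖(weight m * weight n : ℂ) * hilbertMatrix m n‖ₑ := by
  have : (0 : ℝ) < (n : ℕ) := Nat.cast_pos.2 n.pos
  have hlog := log_natCast_add_one_pos n.pos
  have hharm : Real.log ((n : ℕ) + 1) ≤ ∑ j ∈ Finset.range n, 1 / ((j : ℝ) + 1) := by
    simpa [harmonic] using log_add_one_le_harmonic n
  have hreal : 1 / (((n : ℕ) : ℝ) * Real.log ((n : ℕ) + 1)) ≤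
      4 * ∑ j ∈ Finset.range n, weight n ^ 2 / 4 / ((j : ℝ) + 1) :=
    calc 1 / (((n : ℕ) : ℝ) * Real.log ((n : ℕ) + 1))
        = weight n ^ 2 * Real.log ((n : ℕ) + 1) := by
          rw [weight_sq]
          field_simp
      _ ≤ weight n ^ 2 * ∑ j ∈ Finset.range n, 1 / ((j : ℝ) + 1) := by gcongr
      _ = 4 * ∑ j ∈ Finset.range n, weight n ^ 2 / 4 / ((j : ℝ) + 1) := by
          rw [Finset.mul_sum, Finset.mul_sum]
          exact Finset.sum_congr rfl fun j _ => by ring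
  have hinj : Function.Injective fun j : ℕ => n + j.succPNat :=
    (add_right_injective n).comp Nat.succPNat_injective
  calc ‖1 / (((n : ℕ) : ℝ) * Real.log ((n : ℕ) + 1))‖ₑ
      ≤ 4 * ∑ j ∈ Finset.range n, ENNReal.ofReal (weight n ^ 2 / 4 / (j + 1)) := by
        rw [Real.enorm_of_nonneg (by positivity),
          ← ENNReal.ofReal_sum_of_nonneg fun j _ => by positivity, ← ENNReal.ofReal_ofNat 4,
          ← ENNReal.ofReal_mul zero_le_four]
        exact ENNReal.ofReal_le_ofReal hreal
    _ ≤ 4 * ∑ j ∈ Finset.range n,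
          ‖(weight (n + j.succPNat) * weight n : ℂ) * hilbertMatrix (n + j.succPNat) n‖ₑ := by
        gcongr with j hj
        rw [← ofReal_norm]
        exact ENNReal.ofReal_le_ofReal (weight_sq_div_le n (Finset.mem_range.1 hj))
    _ ≤ 4 * ∑' m, ‖(weight m * weight n : ℂ) * hilbertMatrix m n‖ₑ := by
        gcongr
        exact (ENNReal.sum_le_tsum _).trans (ENNReal.tsum_comp_le_tsum_of_injective hinj
          fun m => ‖(weight m * weight n : ℂ) * hilbertMatrix m n‖ₑ)

lemma tsum_enorm_weight_mul_hilbertMatrix :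
    ∑' p : ℕ+ × ℕ+, ‖(weight p.1 * weight p.2 : ℂ) * hilbertMatrix p.1 p.2‖ₑ = ⊤ := by
  rw [ENNReal.tsum_prod (f := fun m n => ‖(weight m * weight n : ℂ) * hilbertMatrix m n‖ₑ),
    ENNReal.tsum_comm]
  have h := tsum_enorm_one_div_mul_log.ge.trans (ENNReal.tsum_le_tsum enorm_one_div_mul_log_le_tsum)
  rw [ENNReal.tsum_mul_left, top_le_iff] at h
  exact (ENNReal.mul_eq_top.1 h).resolve_right (fun h' => by simp at h') |>.2

end Weights

section MaximallyCorrelated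

/-- The isometric embedding `|n⟩ ↦ |nn⟩` of `H_A` into `H_A ⊗ H_B`. -/
noncomputable def diagEmbedding : HA →L[ℂ] HAB :=
  orthonormalEmbedding <|
    orthonormal_ket.comp (fun n : ℕ+ => (n, n)) fun _ _ h => (Prod.mk.inj h).1

lemma diagEmbedding_ket (n : ℕ+) : diagEmbedding (ket n) = ket (n, n) :=
  orthonormalEmbedding_ket _ n

lemma adjoint_diagEmbedding_ket (p : ℕ+ × ℕ+) :
    ContinuousLinearMap.adjoint diagEmbedding (ket p) = if p.1 = p.2 then ket p.1 else 0 := by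
  refine ext_inner_ket fun n => ?_
  rw [ContinuousLinearMap.adjoint_inner_right, diagEmbedding_ket, inner_ket_left, ket_apply,
    apply_ite (inner ℂ (ket n)), inner_zero_right, inner_ket_left, ket_apply, ← ite_and]
  grind

/-- The maximally correlated operator `∑ₙₘ ωₙₘ |nn⟩⟨mm|`, the image of `ω` under the isometry
`|n⟩ ↦ |nn⟩`. -/
noncomputable def maxCorrelated (ω : HA →L[ℂ] HA) : HAB →L[ℂ] HAB :=
  diagEmbedding ∘L ω ∘L ContinuousLinearMap.adjoint diagEmbedding

lemma maxCorrelated_add (ω ω' : HA →L[ℂ] HA) :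
    maxCorrelated (ω + ω') = maxCorrelated ω + maxCorrelated ω' := by
  simp only [maxCorrelated, ContinuousLinearMap.add_comp, ContinuousLinearMap.comp_add]

lemma maxCorrelated_smul (a : ℂ) (ω : HA →L[ℂ] HA) :
    maxCorrelated (a • ω) = a • maxCorrelated ω := by
  simp only [maxCorrelated, ContinuousLinearMap.smul_comp, ContinuousLinearMap.comp_smul]

lemma inner_ket_maxCorrelated (ω : HA →L[ℂ] HA) (p q : ℕ+ × ℕ+) :
    ⟪ket p, maxCorrelated ω (ket q)⟫_ℂ =
      if p.1 = p.2 ∧ q.1 = q.2 then ⟪ket p.1, ω (ket q.1)⟫_ℂ else 0 := by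
  rw [maxCorrelated, ContinuousLinearMap.comp_apply, ← ContinuousLinearMap.adjoint_inner_left,
    ContinuousLinearMap.comp_apply, adjoint_diagEmbedding_ket, adjoint_diagEmbedding_ket, ite_and]
  split_ifs <;> simp only [map_zero, inner_zero_left, inner_zero_right]

lemma hasSum_ite_diag {α M : Type*} [DecidableEq α] [AddCommMonoid M] [TopologicalSpace M]
    {f : α → M} {a : M} :
    HasSum (fun p : α × α => if p.1 = p.2 then f p.1 else 0) a ↔ HasSum f a := by
  have hinj : Function.Injective fun n : α => (n, n) := fun a b h => (Prod.mk.inj h).1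
  rw [← hinj.hasSum_iff]
  · simp [Function.comp_def]
  · rintro ⟨n, m⟩ h
    exact if_neg fun hnm => h ⟨n, Prod.ext rfl hnm⟩

lemma maxCorrelated_mem_densityOperators {ω : HA →L[ℂ] HA} (hω : ω ∈ densityOperators ℕ+) :
    maxCorrelated ω ∈ densityOperators (ℕ+ × ℕ+) := by
  refine ⟨hω.1.conj_adjoint _, ?_⟩
  simpa only [inner_ket_maxCorrelated, and_self] using hasSum_ite_diag.2 hω.2

lemma maxCorrelated_ket_of_diagonal {ω : HA →L[ℂ] HA} {a : ℕ+ → ℂ}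
    (hω : ∀ n, ω (ket n) = a n • ket n) (q : ℕ+ × ℕ+) :
    maxCorrelated ω (ket q) = (if q.1 = q.2 then a q.1 else 0) • ket q := by
  rw [maxCorrelated, ContinuousLinearMap.comp_apply, ContinuousLinearMap.comp_apply,
    adjoint_diagEmbedding_ket]
  split_ifs with h
  · rw [hω, map_smul, diagEmbedding_ket, show (q.1, q.1) = q from Prod.ext rfl h]
  · rw [map_zero, map_zero, zero_smul]

lemma maxCorrelated_mem_separableStates_of_diagonal {ω : HA →L[ℂ] HA} {p : ℕ+ → ℝ}
    (hp : ∀ n, 0 ≤ p n) (hsum : HasSum p 1) (hω : ∀ n, ω (ket n) = (p n : ℂ) • ket n) :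
    maxCorrelated ω ∈ separableStates := by
  refine mem_separableStates_of_diagonal (p := fun q => if q.1 = q.2 then p q.1 else 0)
    (fun q => ?_) (hasSum_ite_diag.2 hsum) fun q => ?_
  · split_ifs
    exacts [hp q.1, le_rfl]
  · rw [maxCorrelated_ket_of_diagonal hω, apply_ite ((↑) : ℝ → ℂ), Complex.ofReal_zero]

lemma exists_hasMatrix_partialTransposeMatrix_maxCorrelated (ω : HA →L[ℂ] HA) :
    ∃ S : HAB →L[ℂ] HAB, HasMatrix S (partialTransposeMatrix (maxCorrelated ω)) ∧
      ∀ q, S (ket q) = ⟪ket q.2, ω (ket q.1)⟫_ℂ • ket q.swap := by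
  let a : ℓ^∞(ℕ+ × ℕ+, ℂ) := ⟨fun q => ⟪ket q.2, ω (ket q.1)⟫_ℂ, memℓp_infty ⟨‖ω‖,
    Set.forall_mem_range.2 fun q => (norm_inner_le_norm _ _).trans <| by
      simpa only [norm_ket, one_mul] using norm_apply_ket_le ω q.1⟩⟩
  let W := orthonormalEmbedding (orthonormal_ket.comp (Prod.swap : ℕ+ × ℕ+ → _) Prod.swap_injective)
  have hS (q : ℕ+ × ℕ+) : (W ∘L diagOp a) (ket q) = ⟪ket q.2, ω (ket q.1)⟫_ℂ • ket q.swap := by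
    rw [ContinuousLinearMap.comp_apply, diagOp_ket, map_smul, orthonormalEmbedding_ket]
    rfl
  refine ⟨W ∘L diagOp a, fun p q => ?_, hS⟩
  have hswap : ⟪ket p, ket q.swap⟫_ℂ = if p.1 = q.2 ∧ q.1 = p.2 then 1 else 0 := by
    rw [inner_ket_left, ket_apply]
    grind
  rw [hS, inner_smul_right, hswap, mul_ite, mul_one, mul_zero, partialTransposeMatrix,
    inner_ket_maxCorrelated]
  exact ite_congr rfl (fun h => by rw [h.1]) fun _ => rfl

lemma hasMatrix_partialTranspose_maxCorrelated (ω : HA →L[ℂ] HA) :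
    HasMatrix (partialTranspose (maxCorrelated ω)) (partialTransposeMatrix (maxCorrelated ω)) :=
  let ⟨_, hS, _⟩ := exists_hasMatrix_partialTransposeMatrix_maxCorrelated ω
  hS.opOfMatrix

lemma partialTranspose_maxCorrelated_ket (ω : HA →L[ℂ] HA) (q : ℕ+ × ℕ+) :
    partialTranspose (maxCorrelated ω) (ket q) = ⟪ket q.2, ω (ket q.1)⟫_ℂ • ket q.swap := by
  obtain ⟨S, hS, hSket⟩ := exists_hasMatrix_partialTransposeMatrix_maxCorrelated ω
  rw [partialTranspose, hS.opOfMatrix_eq, hSket]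

lemma diagBlockNorm_maxCorrelated (ω : HA →L[ℂ] HA) :
    diagBlockNorm (maxCorrelated ω) = ∑' p : ℕ+ × ℕ+, ‖⟪ket p.1, ω (ket p.2)⟫_ℂ‖ₑ := by
  simp only [diagBlockNorm, inner_ket_maxCorrelated, and_self, if_true]

lemma traceNorm_partialTranspose_maxCorrelated (ω : HA →L[ℂ] HA) :
    traceNorm (partialTranspose (maxCorrelated ω)) =
      ∑' p : ℕ+ × ℕ+, ‖⟪ket p.1, ω (ket p.2)⟫_ℂ‖ₑ := by
  rw [traceNorm_eq_tsum_of_orthogonal fun p q hpq => ?_]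
  · rw [← (Equiv.prodComm ℕ+ ℕ+).tsum_eq]
    refine tsum_congr fun p => ?_
    rw [partialTranspose_maxCorrelated_ket, enorm_smul, ← ofReal_norm (ket _), norm_ket,
      ENNReal.ofReal_one, mul_one]
    rfl
  · simp only [partialTranspose_maxCorrelated_ket, inner_smul_left, inner_smul_right,
      orthonormal_ket.2 (Prod.swap_injective.ne hpq), mul_zero]

end MaximallyCorrelated

section States

lemma isPositive_one_add_of_norm_le_one {E : Type*} [NormedAddCommGroup E]
    [InnerProductSpace ℂ E] [CompleteSpace E] {A : E →L[ℂ] E} (hA : IsSelfAdjoint A)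
    (hnorm : ‖A‖ ≤ 1) : (1 + A).IsPositive := by
  rw [← ContinuousLinearMap.nonneg_iff_isPositive, ← neg_le_iff_add_nonneg']
  calc -1 ≤ -algebraMap ℝ (E →L[ℂ] E) ‖A‖ := by
        rw [← map_one (algebraMap ℝ (E →L[ℂ] E))]
        exact neg_le_neg (algebraMap_mono _ hnorm)
    _ ≤ A := hA.neg_algebraMap_norm_le_self

lemma hasMatrix_weightOperator : HasMatrix weightOperator weightMatrix :=
  HasMatrix.opOfMatrix <| hasMatrix_diagOp ⟨fun n => (weight n : ℂ), memℓp_infty ⟨√normConst,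
    Set.forall_mem_range.2 fun n => (Complex.norm_of_nonneg (weight_pos n).le).trans_le
      (weight_le n)⟩⟩

lemma isSelfAdjoint_weightOperator : IsSelfAdjoint weightOperator :=
  hasMatrix_weightOperator.isSelfAdjoint fun n m => by
    rw [weightMatrix, weightMatrix, apply_ite star, star_zero]
    exact ite_congr (propext eq_comm) (fun h => by rw [h]; exact Complex.conj_ofReal _) fun _ => rfl

lemma weightOperator_ket (n : ℕ+) : weightOperator (ket n) = (weight n : ℂ) • ket n := by
  refine ext_inner_ket fun m => ?_
  rw [hasMatrix_weightOperator, weightMatrix, inner_smul_right, inner_ket_left, ket_apply,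
    mul_ite, mul_one, mul_zero]
  exact ite_congr rfl (fun h => by rw [h]) fun _ => rfl

lemma star_hilbertMatrix (n m : ℕ+) : star (hilbertMatrix m n) = -hilbertMatrix n m := by
  rw [hilbertMatrix, hilbertMatrix]
  split_ifs with hmn hnm hnm
  · rw [star_zero, neg_zero]
  · exact absurd hmn.symm hnm
  · exact absurd hnm.symm hmn
  · rw [star_div₀, star_one, star_sub, star_natCast, star_natCast, ← neg_sub, div_neg]

lemma isSelfAdjoint_smul_hilbertOperator (s : ℤˣ) :
    IsSelfAdjoint ((((s : ℤ) : ℂ) * (Complex.I / Real.pi)) • hilbertOperator) := by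
  refine HasMatrix.isSelfAdjoint
    (a := fun n m => ((s : ℤ) : ℂ) * (Complex.I / Real.pi) * hilbertMatrix n m) (fun n m => ?_)
    fun n m => ?_
  · rw [smul_apply, inner_smul_right, hasMatrix_hilbertOperator]
  · rw [star_mul', star_hilbertMatrix, star_mul', star_intCast, star_div₀]
    simp only [RCLike.star_def, Complex.conj_I, Complex.conj_ofReal]
    ring

lemma norm_smul_hilbertOperator_le (s : ℤˣ) :
    ‖(((s : ℤ) : ℂ) * (Complex.I / Real.pi)) • hilbertOperator‖ ≤ 1 := by
  have hs : ‖((s : ℤ) : ℂ)‖ = 1 := by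
    rw [Complex.norm_intCast, ← Int.norm_eq_abs, Int.norm_coe_units]
  rw [norm_smul, norm_mul, hs, one_mul, norm_div, Complex.norm_I,
    Complex.norm_of_nonneg Real.pi_pos.le, one_div_mul_eq_div, div_le_one Real.pi_pos]
  exact norm_hilbertOperator_le

lemma isPositive_omega (s : ℤˣ) : (omega s).IsPositive := by
  have h := (isPositive_one_add_of_norm_le_one (isSelfAdjoint_smul_hilbertOperator s)
    (norm_smul_hilbertOperator_le s)).conj_adjoint weightOperator
  rw [isSelfAdjoint_weightOperator.adjoint_eq] at h
  exact h.smul_of_nonneg (inv_nonneg.2 (Complex.zero_le_real.2 normConst_pos.le))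

lemma inner_ket_omega (s : ℤˣ) (n m : ℕ+) :
    ⟪ket n, omega s (ket m)⟫_ℂ = (normConst : ℂ)⁻¹ * (weight n * weight m *
      ((if n = m then 1 else 0) + ((s : ℤ) : ℂ) * (Complex.I / Real.pi) * hilbertMatrix n m)) := by
  rw [omega, smul_apply, mul_apply_eq_comp, mul_apply_eq_comp, inner_smul_right,
    ← isSelfAdjoint_weightOperator.adjoint_eq, ContinuousLinearMap.adjoint_inner_right,
    isSelfAdjoint_weightOperator.adjoint_eq, weightOperator_ket, weightOperator_ket, map_smul,
    inner_smul_left, inner_smul_right, add_apply, one_apply_eq_self, smul_apply, inner_add_right,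
    inner_smul_right, hasMatrix_hilbertOperator, inner_ket_left, ket_apply, Complex.conj_ofReal]
  ring

lemma inner_ket_omega_self (s : ℤˣ) (n : ℕ+) :
    ⟪ket n, omega s (ket n)⟫_ℂ = ((weight n ^ 2 / normConst : ℝ) : ℂ) := by
  rw [inner_ket_omega, hilbertMatrix, if_pos rfl, if_pos rfl]
  push_cast
  ring

lemma omega_mem_densityOperators (s : ℤˣ) : omega s ∈ densityOperators ℕ+ := by
  refine ⟨isPositive_omega s, ?_⟩
  simp_rw [inner_ket_omega_self]
  rw [← Complex.ofReal_one, Complex.hasSum_ofReal]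
  exact hasSum_weight_sq_div

lemma half_omega_add_omega_ket (n : ℕ+) :
    ((1 / 2 : ℂ) • (omega 1 + omega (-1))) (ket n) =
      ((weight n ^ 2 / normConst : ℝ) : ℂ) • ket n := by
  have h : (1 / 2 : ℂ) • (omega 1 + omega (-1)) =
      (normConst : ℂ)⁻¹ • (weightOperator * weightOperator) := by
    simp only [omega, Units.val_one, Units.val_neg, Int.cast_one, Int.cast_neg, neg_mul, neg_smul,
      mul_add, add_mul, mul_neg, mul_one]
    module
  rw [h, smul_apply, mul_apply_eq_comp, weightOperator_ket, map_smul, weightOperator_ket,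
    smul_smul, smul_smul]
  congr 1
  push_cast
  ring

lemma le_enorm_inner_ket_omega (s : ℤˣ) (n m : ℕ+) :
    ‖(normConst : ℂ)⁻¹ * (((s : ℤ) : ℂ) * (Complex.I / Real.pi))‖ₑ *
        ‖(weight n * weight m : ℂ) * hilbertMatrix n m‖ₑ ≤ ‖⟪ket n, omega s (ket m)⟫_ℂ‖ₑ := by
  rcases eq_or_ne n m with h | h
  · rw [hilbertMatrix, if_pos h, mul_zero, enorm_zero, mul_zero]
    exact zero_le
  · rw [inner_ket_omega, if_neg h, zero_add, ← enorm_mul]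
    exact le_of_eq <| congrArg _ <| by ring

lemma tsum_enorm_inner_ket_omega (s : ℤˣ) :
    ∑' p : ℕ+ × ℕ+, ‖⟪ket p.1, omega s (ket p.2)⟫_ℂ‖ₑ = ⊤ := by
  have hcoef : (normConst : ℂ)⁻¹ * (((s : ℤ) : ℂ) * (Complex.I / Real.pi)) ≠ 0 :=
    mul_ne_zero (inv_ne_zero (Complex.ofReal_ne_zero.2 normConst_pos.ne'))
      (mul_ne_zero (Int.cast_ne_zero.2 s.ne_zero)
        (div_ne_zero Complex.I_ne_zero (Complex.ofReal_ne_zero.2 Real.pi_ne_zero)))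
  have h := ENNReal.tsum_le_tsum fun p : ℕ+ × ℕ+ => le_enorm_inner_ket_omega s p.1 p.2
  rwa [ENNReal.tsum_mul_left, tsum_enorm_weight_mul_hilbertMatrix,
    ENNReal.mul_top (enorm_ne_zero.2 hcoef), top_le_iff] at h

lemma hasMatrix_maxCorrelated_omega (s : ℤˣ) :
    HasMatrix (maxCorrelated (omega s)) (rhoMatrix s) :=
  inner_ket_maxCorrelated (omega s)

lemma rho_eq_maxCorrelated (s : ℤˣ) : rho s = maxCorrelated (omega s) :=
  (hasMatrix_maxCorrelated_omega s).opOfMatrix_eq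

lemma hasMatrix_rho (s : ℤˣ) : HasMatrix (rho s) (rhoMatrix s) :=
  (hasMatrix_maxCorrelated_omega s).opOfMatrix

lemma rho_mem_densityOperators (s : ℤˣ) : rho s ∈ densityOperators (ℕ+ × ℕ+) :=
  rho_eq_maxCorrelated s ▸ maxCorrelated_mem_densityOperators (omega_mem_densityOperators s)

lemma hasMatrix_partialTranspose_rho (s : ℤˣ) :
    HasMatrix (partialTranspose (rho s)) (partialTransposeMatrix (rho s)) :=
  rho_eq_maxCorrelated s ▸ hasMatrix_partialTranspose_maxCorrelated (omega s)

lemma traceNorm_partialTranspose_rho (s : ℤˣ) : traceNorm (partialTranspose (rho s)) = ⊤ := by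
  rw [rho_eq_maxCorrelated, traceNorm_partialTranspose_maxCorrelated, tsum_enorm_inner_ket_omega]

lemma negativity_rho (s : ℤˣ) : negativity (rho s) = ⊤ :=
  negativity_eq_top (traceNorm_partialTranspose_rho s)

lemma standardRobustness_rho (s : ℤˣ) : standardRobustness separableStates (rho s) = ⊤ :=
  standardRobustness_separableStates_eq_top <| by
    rw [rho_eq_maxCorrelated, diagBlockNorm_maxCorrelated, tsum_enorm_inner_ket_omega]

lemma half_rho_add_rho_mem_separableStates :
    (1 / 2 : ℂ) • (rho 1 + rho (-1)) ∈ separableStates := by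
  rw [rho_eq_maxCorrelated, rho_eq_maxCorrelated, ← maxCorrelated_add, ← maxCorrelated_smul]
  exact maxCorrelated_mem_separableStates_of_diagonal
    (fun n => div_nonneg (sq_nonneg _) normConst_pos.le) hasSum_weight_sq_div
    half_omega_add_omega_ket

lemma generalizedRobustness_rho_le (s : ℤˣ) :
    generalizedRobustness separableStates (rho s) ≤ 2 := by
  have hmix : ((1 + 1 : ℝ) : ℂ)⁻¹ • (rho s + ((1 : ℝ) : ℂ) • rho (-s)) ∈ separableStates := by
    have hcoef : ((1 + 1 : ℝ) : ℂ)⁻¹ = 1 / 2 := by norm_num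
    rw [hcoef, Complex.ofReal_one, one_smul]
    rcases Int.units_eq_one_or s with rfl | rfl
    · exact half_rho_add_rho_mem_separableStates
    · rw [neg_neg, add_comm]
      exact half_rho_add_rho_mem_separableStates
  refine (generalizedRobustness_le_of_mem zero_le_one (rho_mem_densityOperators (-s)) hmix).trans ?_
  norm_num

end States

theorem mainTheorem9 :
    -- the operators are well defined: bounded operators with the prescribed matrices exist
    HasMatrix hilbertOperator hilbertMatrix ∧
    HasMatrix weightOperator weightMatrix ∧
    (Summable fun n : ℕ+ => weight n ^ 2) ∧ 0 < normConst ∧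
    (∀ s : ℤˣ, HasMatrix (rho s) (rhoMatrix s)) ∧
    (∀ s : ℤˣ, HasMatrix (partialTranspose (rho s)) (partialTransposeMatrix (rho s))) ∧
    -- `ω_±` and `ρ_±` are states
    (∀ s : ℤˣ, omega s ∈ densityOperators ℕ+) ∧
    (∀ s : ℤˣ, rho s ∈ densityOperators (ℕ+ × ℕ+)) ∧
    -- infinite negativity and standard robustness
    (∀ s : ℤˣ, traceNorm (partialTranspose (rho s)) = ⊤) ∧
    (∀ s : ℤˣ, negativity (rho s) = ⊤) ∧
    (∀ s : ℤˣ, standardRobustness separableStates (rho s) = ⊤) ∧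
    -- the balanced mixture is separable, and the generalized robustness is at most two
    (1 / 2 : ℂ) • (rho 1 + rho (-1)) ∈ separableStates ∧
    (∀ s : ℤˣ, generalizedRobustness separableStates (rho s) ≤ 2) := by
  exact ⟨hasMatrix_hilbertOperator, hasMatrix_weightOperator, summable_weight_sq, normConst_pos,
    hasMatrix_rho, hasMatrix_partialTranspose_rho, omega_mem_densityOperators,
    rho_mem_densityOperators, traceNorm_partialTranspose_rho, negativity_rho,
    standardRobustness_rho, half_rho_add_rho_mem_separableStates, generalizedRobustness_rho_le⟩
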